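/- Let $D=\{(x,y)\in\mathbb R^2 : x^2+y^2<1\}$, with boundary circle $S^1$. **Circle map and rotation number.** For a compact convex non-empty set $U\subset D$ and $v\in S^1$, let $\psi_U(v)$ be the point of $S^1$ closest to $v$ in the counterclockwise direction among the points $w\in S^1\setminus\{v\}$ such that the line $vw$ is tangent to (supports) $U$. Equivalently, let $R(v)$ be $v$ rotated by $+90^\circ$ and let $\theta(v)$ be the minimum over $u\in U$ of the gradient $b/a$ of the line $uv$, where $u-v=a\,v+b\,R(v)$; then $\psi_U(v)$ is the second intersection with $S^1$ of the line through $v$ of gradient $\theta(v)$ in the basis $\{v,R(v)\}$. For an orientation preserving homeomorphism $f$ of $S^1\cong\mathbb R/\mathbb Z$ put $\rho(f)=\lim_{n\to\infty}\frac{\bar f^{\,n}(x)-x}{n}$, where $\bar f:\mathbb R\to\mathbb R$ is the lift of $f$ with $\bar f(0)\in[0,1)$ (the limit exists and does not depend on $x\in\mathbb R$). **Distances.** For distinct $P,Q\in D$ let $v_1,v_2\in S^1$ be the two points in which the line $PQ$ meets $S^1$, and put $$d'(P,Q)=\frac12\left|\log\frac{|v_1Q|\,|v_2P|}{|v_1P|\,|v_2Q|}\right|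 ,\qquad d'(P,P)=0 .$$ For distinct $P,Q\in D$ and $R\in D$ put $$\Delta_2'(P,Q)=\log\frac{e^{2d'(P,Q)}+1}{e^{2d'(P,Q)}-1},\qquad \delta(P,Q,R)=\min\{d'(R,S) : S\in D \text{ on the line } PQ\}.$$ **Theorem.** Let $P_1,P_2,P_3\in D$ be the vertices of a (non-degenerate) triangle, and let $\triangle P_1P_2P_3$ be their convex hull. Suppose that $\Delta_2'(P_i,P_j)>\delta(P_i,P_j,P_k)$ for all $i,j,k$ with $\{i,j,k\}=\{1,2,3\}$. Then $\psi_{\triangle P_1P_2P_3}$ is an orientation preserving homeomorphism of $S^1$ and $$\rho(\psi_{\triangle P_1P_2P_3})>\frac25 .$$ -/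

import Mathlib

namespace BarBilliard

noncomputable section

/-! The plane is identified with `ℂ`; the disk `D` is `{z | ‖z‖ < 1}` and its boundary `S¹` is
Mathlib's `Circle`. -/

/-! ### The circle map of a convex set -/

/-- For `v` on the unit circle, the gradient of the line `uv` in the coordinates given by the basis
`{v, R v}`, where `R v = I * v` is `v` turned by a right angle: if `u - v = a • v + b • R v`,
it is `b / a`. (One has `a < 0` for `u` in the disk.) -/
def gradient (v u : ℂ) : ℝ := ((u - v) / v).im / ((u - v) / v).re

/-- The least gradient of a line joining `v` to a point of `U`
(a minimum when `U` is non-empty and compact in the open disk). -/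
def minGradient (U : Set ℂ) (v : Circle) : ℝ := sInf ((fun u => gradient v u) '' U)

/-- The map `ψ_U`: the image of `v` is the second intersection point of the circle with the line
through `v` of gradient `minGradient U v`; see `psi_eq_iff`. -/
def psi (U : Set ℂ) (v : Circle) : Circle :=
  v * Circle.exp (Real.pi + 2 * Real.arctan (minGradient U v))

theorem gradient_mul_exp (v : Circle) {a : ℝ} (h1 : -(Real.pi / 2) < a) (h2 : a < Real.pi / 2) :
    gradient v (v * Circle.exp (Real.pi + 2 * a) : Circle) = Real.tan a := by
  have hc : 0 < Real.cos a := Real.cos_pos_of_mem_Ioo ⟨h1, h2⟩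
  have hv : (v : ℂ) ≠ 0 := v.coe_ne_zero
  have key : (((v * Circle.exp (Real.pi + 2 * a) : Circle) : ℂ) - v) / v
      = Complex.exp ((Real.pi + 2 * a : ℝ) * Complex.I) - 1 := by
    rw [Circle.coe_mul, Circle.coe_exp]; field_simp
  rw [gradient, key, Complex.sub_im, Complex.sub_re, Complex.exp_ofReal_mul_I_re,
    Complex.exp_ofReal_mul_I_im, Real.tan_eq_sin_div_cos, add_comm, Real.cos_add_pi,
    Real.sin_add_pi, Real.sin_two_mul, Real.cos_two_mul]
  simp only [Complex.one_re, Complex.one_im]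
  have : -(2 * Real.cos a ^ 2 - 1) - 1 ≠ 0 := by nlinarith [pow_pos hc 2]
  field_simp
  ring

/-- `ψ_U v` is the point of the circle other than `v` on the line through `v` of gradient
`minGradient U v`. -/
theorem psi_eq_iff (U : Set ℂ) (v w : Circle) :
    psi U v = w ↔ w ≠ v ∧ gradient v w = minGradient U v := by
  constructor
  · rintro rfl
    refine ⟨fun h => ?_, ?_⟩
    · rw [psi, mul_eq_left] at h
      have h2 := congrArg (fun z : Circle => (z : ℂ).re) h
      simp only [Circle.coe_exp, Complex.exp_ofReal_mul_I_re, Circle.coe_one, Complex.one_re] at h2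
      rw [add_comm, Real.cos_add_pi, Real.cos_two_mul] at h2
      nlinarith [pow_pos (Real.cos_arctan_pos (minGradient U v)) 2]
    · rw [psi, gradient_mul_exp v (Real.neg_pi_div_two_lt_arctan _) (Real.arctan_lt_pi_div_two _),
        Real.tan_arctan]
  · rintro ⟨hne, hg⟩
    set a := Complex.arg ((-(w / v) : Circle) : ℂ) / 2 with ha
    have hw : w = v * Circle.exp (Real.pi + 2 * a) := by
      have : Circle.exp (2 * a) = -(w / v) := by
        rw [ha, mul_div_cancel₀ _ (two_ne_zero)]; exact Circle.exp_arg _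
      rw [Circle.exp_add, this]
      ext1
      simp [mul_div_cancel₀ _ v.coe_ne_zero]
    have h1 : -(Real.pi / 2) < a := by
      have := Complex.neg_pi_lt_arg ((-(w / v) : Circle) : ℂ); linarith
    have h2 : a < Real.pi / 2 := by
      have h3 := Complex.arg_le_pi ((-(w / v) : Circle) : ℂ)
      rcases h3.lt_or_eq with h3 | h3
      · linarith
      · exfalso
        apply hne
        rw [hw, ha, h3, mul_div_cancel₀ _ (two_ne_zero), ← two_mul, Circle.exp_two_pi, mul_one]
    rw [hw] at hg ⊢
    rw [gradient_mul_exp v h1 h2] at hg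
    rw [psi, ← hg, Real.arctan_tan h1 h2]

/-! ### The rotation number -/

/-- The projection `ℝ → ℝ/ℤ = S¹`. -/
def proj (x : ℝ) : Circle := Circle.exp (2 * Real.pi * x)

/-- `g` is the lift, with `g 0 ∈ [0, 1)`, of the orientation preserving homeomorphism `f` of the
circle: `g` is continuous, strictly increasing, satisfies `g (x + 1) = g x + 1`, and covers `f`.
(The maps of the circle that have such a lift are its orientation preserving homeomorphisms.) -/
structure IsNormalizedLift (f : Circle → Circle) (g : CircleDeg1Lift) : Prop where
  continuous : Continuous g
  strictMono : StrictMono g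
  semiconj : ∀ x, proj (g x) = f (proj x)
  map_zero_mem : g 0 ∈ Set.Ico (0 : ℝ) 1

open Classical in
/-- The rotation number `lim (gⁿ x - x) / n` of an orientation preserving homeomorphism `f` of the
circle, where `g` is the normalized lift of `f`. The value is `0` by convention if `f` is not an
orientation preserving homeomorphism. -/
def rotationNumber (f : Circle → Circle) : ℝ :=
  if h : ∃ g : CircleDeg1Lift, IsNormalizedLift f g then h.choose.translationNumber else 0

theorem proj_eq_iff {x y : ℝ} : proj x = proj y ↔ ∃ n : ℤ, x = y + n := by
  rw [proj, proj, Circle.exp_eq_exp]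
  have hpi := Real.pi_pos
  refine exists_congr fun n => ⟨fun h => ?_, fun h => by rw [h]; ring⟩
  have : (2 * Real.pi) * (x - (y + n)) = 0 := by linarith
  rcases mul_eq_zero.1 this with h | h <;> linarith

/-- The normalized lift is unique. -/
theorem IsNormalizedLift.unique {f : Circle → Circle} {g h : CircleDeg1Lift}
    (hg : IsNormalizedLift f g) (hh : IsNormalizedLift f h) : g = h := by
  have hint : ∀ x, ∃ n : ℤ, g x - h x = n := fun x => by
    obtain ⟨n, hn⟩ := proj_eq_iff.1 ((hg.semiconj x).trans (hh.semiconj x).symm)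
    exact ⟨n, by linarith⟩
  have h0 : g 0 - h 0 = 0 := by
    obtain ⟨n, hn⟩ := hint 0
    have a := hg.map_zero_mem
    have b := hh.map_zero_mem
    have h1 : (n : ℝ) < 1 := by rw [← hn]; linarith [a.2, b.1]
    have h2 : (-1 : ℝ) < n := by rw [← hn]; linarith [a.1, b.2]
    have : n = 0 := by
      have h1' : n < 1 := by exact_mod_cast h1
      have h2' : -1 < n := by exact_mod_cast h2
      omega
    rw [hn, this, Int.cast_zero]
  have hc : Continuous fun x => g x - h x := hg.continuous.sub hh.continuous
  have half : ∀ (c : ℝ), (∀ n : ℤ, c ≠ n) → ∀ y, g y - h y ≠ c := fun c hcn y hy => by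
    obtain ⟨n, hn⟩ := hint y
    exact hcn n (hy.symm.trans hn)
  have nothalf : ∀ n : ℤ, (1 / 2 : ℝ) ≠ n := fun n hn => by
    have : (1 : ℝ) = ((2 * n : ℤ) : ℝ) := by push_cast; linarith
    have : (1 : ℤ) = 2 * n := by exact_mod_cast this
    omega
  have nothalf' : ∀ n : ℤ, (-(1 / 2) : ℝ) ≠ n := fun n hn =>
    nothalf (-n) (by push_cast; linarith)
  ext x
  obtain ⟨n, hn⟩ := hint x
  rcases lt_trichotomy n 0 with hlt | heq | hgt
  · have : (n : ℝ) ≤ -1 := by exact_mod_cast (by omega : n ≤ -1)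
    obtain ⟨y, hy⟩ := mem_range_of_exists_le_of_exists_ge (c := -(1 / 2)) hc
      ⟨x, by simp only [hn]; linarith⟩ ⟨0, by simp only [h0]; norm_num⟩
    exact absurd hy (half _ nothalf' y)
  · rw [heq, Int.cast_zero] at hn
    linarith
  · have : (1 : ℝ) ≤ n := by exact_mod_cast (by omega : 1 ≤ n)
    obtain ⟨y, hy⟩ := mem_range_of_exists_le_of_exists_ge (c := 1 / 2) hc
      ⟨0, by simp only [h0]; norm_num⟩ ⟨x, by simp only [hn]; linarith⟩
    exact absurd hy (half _ nothalf y)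

theorem IsNormalizedLift.rotationNumber_eq {f : Circle → Circle} {g : CircleDeg1Lift}
    (hg : IsNormalizedLift f g) : rotationNumber f = g.translationNumber := by
  have h : ∃ g : CircleDeg1Lift, IsNormalizedLift f g := ⟨g, hg⟩
  rw [rotationNumber, dif_pos h, h.choose_spec.unique hg]

/-! ### Distances in the Beltrami–Klein model -/

/-- The end on the unit circle of the ray from `P` (a point of the disk) through `Q ≠ P`: the point
`P + s • (Q - P)`, with `s` the non-negative root of `‖P + s • (Q - P)‖ ^ 2 = 1`;
see `eq_rayEnd_iff`. -/
def rayEnd (P Q : ℂ) : ℂ :=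
  P + ((-inner ℝ P (Q - P) + √(inner ℝ P (Q - P) ^ 2 + ‖Q - P‖ ^ 2 * (1 - ‖P‖ ^ 2)))
    / ‖Q - P‖ ^ 2 : ℝ) • (Q - P)

theorem eq_rayEnd_iff {P Q v : ℂ} (hP : ‖P‖ < 1) (hPQ : P ≠ Q) :
    v = rayEnd P Q ↔ ‖v‖ = 1 ∧ ∃ s : ℝ, 0 ≤ s ∧ v = P + s • (Q - P) := by
  have hw : 0 < ‖Q - P‖ ^ 2 := by
    have := norm_pos_iff.2 (sub_ne_zero.2 hPQ.symm); positivity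
  have hc : 0 < 1 - ‖P‖ ^ 2 := by nlinarith [norm_nonneg P]
  have hn : ∀ s : ℝ, ‖P + s • (Q - P)‖ ^ 2
      = ‖P‖ ^ 2 + 2 * s * inner ℝ P (Q - P) + s ^ 2 * ‖Q - P‖ ^ 2 := fun s => by
    rw [norm_add_sq_real, inner_smul_right, norm_smul, mul_pow, Real.norm_eq_abs, sq_abs]; ring
  unfold rayEnd
  generalize inner ℝ P (Q - P) = b at *
  generalize hW : ‖Q - P‖ ^ 2 = W at *
  generalize hC : 1 - ‖P‖ ^ 2 = C at *
  have hr0 : 0 ≤ √(b ^ 2 + W * C) := Real.sqrt_nonneg _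
  have hr : √(b ^ 2 + W * C) ^ 2 = b ^ 2 + W * C := Real.sq_sqrt (by positivity)
  generalize √(b ^ 2 + W * C) = r at *
  have hWC : 0 < W * C := mul_pos hw hc
  have hbr : |b| < r := abs_lt_of_sq_lt_sq (by linarith) hr0
  have hbr' := abs_lt.1 hbr
  constructor
  · rintro rfl
    refine ⟨?_, (-b + r) / W, div_nonneg (by linarith) hw.le, rfl⟩
    have h2 : ‖P + ((-b + r) / W) • (Q - P)‖ ^ 2 = 1 := by
      rw [hn]; field_simp; nlinarith
    exact (pow_eq_one_iff_of_nonneg (norm_nonneg _) two_ne_zero).1 h2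
  · rintro ⟨h1, s, hs, rfl⟩
    have h2 := hn s
    rw [h1] at h2
    have h3 : (s * W + b - r) * (s * W + b + r) = 0 := by nlinarith
    have h4 : 0 < s * W + b + r := by nlinarith [mul_nonneg hs hw.le]
    have h5 : s * W + b - r = 0 := (mul_eq_zero.1 h3).resolve_right h4.ne'
    have h6 : s = (-b + r) / W := by rw [eq_div_iff hw.ne']; linarith
    rw [h6]

/-- The Beltrami–Klein distance `d'(P, Q) = ½ |log (|v₁Q| |v₂P| / (|v₁P| |v₂Q|))|`, where
`v₁ = rayEnd Q P` and `v₂ = rayEnd P Q` are the two points in which the line `PQ` meets the unit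
circle. For `P = Q` the value of the expression is `0`. -/
def dist' (P Q : ℂ) : ℝ :=
  1 / 2 * |Real.log (‖rayEnd Q P - Q‖ * ‖rayEnd P Q - P‖
    / (‖rayEnd Q P - P‖ * ‖rayEnd P Q - Q‖))|

theorem dist'_self (P : ℂ) : dist' P P = 0 := by simp [dist', rayEnd]

/-- `δ(P, Q, R)`: the least distance from `R` to a point of the hyperbolic line `PQ`. -/
def delta (P Q R : ℂ) : ℝ :=
  sInf {r : ℝ | ∃ S : ℂ, S ∈ line[ℝ, P, Q] ∧ ‖S‖ < 1 ∧ r = dist' R S}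

/-- `Δₙ'(P, Q) = log ((exp (n d'(P, Q)) + 1) / (exp (n d'(P, Q)) - 1))`. -/
def Delta' (n : ℕ) (P Q : ℂ) : ℝ :=
  Real.log ((Real.exp (n * dist' P Q) + 1) / (Real.exp (n * dist' P Q) - 1))

end

end BarBilliard

/-!
`psi` of the convex hull of finitely many points lifts to the pointwise minimum of the lifts of the
half-turns about these points, because the least gradient over a convex hull is attained at a
vertex. Five iterations of it therefore act at each point as some five-letter word in the half-turns
about the vertices, and it is enough that all these words have translation number greater than `2`.

The square of a half-turn is the translation by `1`. Up to cyclic rotation a five-letter word either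
has a repeated first letter, and shortens to a word of three letters, or has the form `ABABC`; so
only `ABC` and `ABABC` with distinct letters remain. Their translation numbers are at least `1` and
at least `2`, and equality would give a fixed point on the circle. A word of half-turns is a Möbius
transformation given by a matrix proportional to one in `SU(1, 1)`, which has no fixed point on the
circle when `tr² < 4 det`. Here `tr (ABABC) = tr (AB) * tr (ABC)`, where `tr (AB)` measures the
distance of the first two vertices and `tr (ABC)` the area of the triangle, and the comparison of
`Delta'` with `delta` bounds the product.
-/

namespace BarBilliard

/-- A lift of a fixed-point free involution of the circle that advances every point of `ℝ` by less
than one full turn. -/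
def IsHalfTurn (a : CircleDeg1Lift) : Prop := ∀ x, a (a x) = x + 1

theorem translationNumber_mul_comm (f g : CircleDeg1Lift) :
    (f * g).translationNumber = (g * f).translationNumber :=
  CircleDeg1Lift.translationNumber_eq_of_semiconjBy (f := g) (mul_assoc g f g).symm

open scoped List in
theorem translationNumber_prod_eq_of_isRotated {l l' : List CircleDeg1Lift} (h : l ~r l') :
    l.prod.translationNumber = l'.prod.translationNumber := by
  obtain ⟨n, hn, rfl⟩ := List.isRotated_iff_mod.1 h
  rw [List.rotate_eq_drop_append_take hn, List.prod_append, translationNumber_mul_comm,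
    List.prod_take_mul_prod_drop]

namespace IsHalfTurn

variable {a b c : CircleDeg1Lift}

theorem one_le (ha : IsHalfTurn a) : 1 ≤ a := fun x => by
  by_contra! h
  have hle : a (a x) ≤ a x := a.monotone h.le
  rw [ha] at hle
  exact absurd (h.trans (lt_add_one x)) hle.not_gt

theorem commute_mul_self (ha : IsHalfTurn a) (f : CircleDeg1Lift) : Commute (a * a) f := by
  ext x
  simp only [CircleDeg1Lift.mul_apply, ha _, f.map_add_one]

theorem translationNumber_mul_self (ha : IsHalfTurn a) : (a * a).translationNumber = 1 := by
  exact_mod_cast CircleDeg1Lift.translationNumber_of_eq_add_int (a * a) (x := 0) (m := 1)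
    (by simpa using ha 0)

theorem translationNumber_mul_self_mul (ha : IsHalfTurn a) (f : CircleDeg1Lift) :
    (a * (a * f)).translationNumber = 1 + f.translationNumber := by
  rw [← mul_assoc, CircleDeg1Lift.translationNumber_mul_of_commute (ha.commute_mul_self f),
    ha.translationNumber_mul_self]

theorem translationNumber_pos (ha : IsHalfTurn a) : 0 < a.translationNumber := by
  have h := a.translationNumber_pow 2
  rw [sq, ha.translationNumber_mul_self] at h
  push_cast at h
  linarith

/-- `a b` and `b a` have the same translation number, and their product is the translation by
`2`. -/
theorem translationNumber_mul (ha : IsHalfTurn a) (hb : IsHalfTurn b) :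
    (a * b).translationNumber = 1 := by
  have habba : a * b * (b * a) = a * a * (b * b) := by
    rw [mul_assoc, ← mul_assoc b, (hb.commute_mul_self a).eq, mul_assoc]
  have hbaab : b * a * (a * b) = a * a * (b * b) := by
    rw [mul_assoc, ← mul_assoc a, ← mul_assoc, (ha.commute_mul_self b).symm.eq, mul_assoc]
  have h := CircleDeg1Lift.translationNumber_mul_of_commute (habba.trans hbaab.symm)
  rw [habba, mul_assoc, ha.translationNumber_mul_self_mul, hb.translationNumber_mul_self,
    translationNumber_mul_comm b a] at h
  linarith

theorem one_le_translationNumber_mul_mul (ha : IsHalfTurn a) (hb : IsHalfTurn b)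
    (hc : IsHalfTurn c) : 1 ≤ (a * b * c).translationNumber := by
  rw [← ha.translationNumber_mul hb]
  exact CircleDeg1Lift.translationNumber_mono fun x => (a * b).monotone (hc.one_le x)

theorem two_le_translationNumber_mul_mul (ha : IsHalfTurn a) (hb : IsHalfTurn b)
    (hc : IsHalfTurn c) : 2 ≤ (a * b * (a * b) * c).translationNumber := by
  have h : (a * b * (a * b)).translationNumber = 2 := by
    rw [CircleDeg1Lift.translationNumber_mul_of_commute rfl, ha.translationNumber_mul hb]
    norm_num
  rw [← h]
  exact CircleDeg1Lift.translationNumber_mono fun x => (a * b * (a * b)).monotone (hc.one_le x)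

end IsHalfTurn

section Words

open scoped List

theorem exists_isRotated_five (i j k l m : Fin 3) :
    ∃ a b c d e : Fin 3, [i, j, k, l, m] ~r [a, b, c, d, e] ∧
      (a = b ∨ a = c ∧ b = d ∧ a ≠ b ∧ a ≠ e ∧ b ≠ e) := by
  by_contra! h
  have h0 := h i j k l m ⟨0, rfl⟩
  have h1 := h j k l m i ⟨1, rfl⟩
  have h2 := h k l m i j ⟨2, rfl⟩
  have h3 := h l m i j k ⟨3, rfl⟩
  have h4 := h m i j k l ⟨4, rfl⟩
  lia

theorem one_lt_translationNumber_of_word_three {ι : Type*} {f : ι → CircleDeg1Lift}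
    (hf : ∀ i, IsHalfTurn (f i))
    (h : ∀ i j k, i ≠ j → i ≠ k → j ≠ k → (f i * f j * f k).translationNumber ≠ 1) :
    ∀ w : List ι, w.length = 3 → 1 < (w.map f).prod.translationNumber
  | [i, j, k], _ => by
    have repeated : ∀ a b, [i, j, k] ~r [a, a, b] →
        1 < ([i, j, k].map f).prod.translationNumber := fun a b hab => by
      rw [translationNumber_prod_eq_of_isRotated (hab.map f), List.map_cons, List.map_cons,
        List.prod_cons, List.prod_cons, (hf a).translationNumber_mul_self_mul, List.map_singleton,
        List.prod_singleton]
      linarith [(hf b).translationNumber_pos]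
    rcases eq_or_ne i j with rfl | hij
    · exact repeated i k (.refl _)
    rcases eq_or_ne j k with rfl | hjk
    · exact repeated j i ⟨1, rfl⟩
    rcases eq_or_ne i k with rfl | hik
    · exact repeated i j ⟨2, rfl⟩
    simpa only [List.map_cons, List.map_nil, List.prod_cons, List.prod_nil, mul_one, mul_assoc]
      using ((hf i).one_le_translationNumber_mul_mul (hf j) (hf k)).lt_of_ne
        (h i j k hij hik hjk).symm

theorem two_lt_translationNumber_of_word_five {f : Fin 3 → CircleDeg1Lift}
    (hf : ∀ i, IsHalfTurn (f i))
    (h₃ : ∀ i j k, i ≠ j → i ≠ k → j ≠ k → (f i * f j * f k).translationNumber ≠ 1)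
    (h₅ : ∀ i j k, i ≠ j → i ≠ k → j ≠ k →
      (f i * f j * (f i * f j) * f k).translationNumber ≠ 2) :
    ∀ w : List (Fin 3), w.length = 5 → 2 < (w.map f).prod.translationNumber
  | [i, j, k, l, m], _ => by
    obtain ⟨a, b, c, d, e, hrot, rfl | ⟨rfl, rfl, hab, hae, hbe⟩⟩ := exists_isRotated_five i j k l m
      <;> rw [translationNumber_prod_eq_of_isRotated (hrot.map f)]
    · have := one_lt_translationNumber_of_word_three hf h₃ [c, d, e] rfl
      rw [List.map_cons, List.map_cons, List.prod_cons, List.prod_cons,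
        (hf a).translationNumber_mul_self_mul]
      linarith
    · simpa only [List.map_cons, List.map_nil, List.prod_cons, List.prod_nil, mul_one, mul_assoc]
        using ((hf a).two_le_translationNumber_mul_mul (hf b) (hf e)).lt_of_ne
          (h₅ a b e hab hae hbe).symm

end Words

theorem lt_mul_translationNumber_of_words {ι : Type*} {f : ι → CircleDeg1Lift} {g : CircleDeg1Lift}
    (hg : Continuous g) (hfg : ∀ x, ∃ i, g x = f i x) {m : ℤ} {n : ℕ}
    (h : ∀ w : List ι, w.length = n → m < (w.map f).prod.translationNumber) :
    m < n * g.translationNumber := by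
  have exists_word : ∀ (n : ℕ) x, ∃ w : List ι, w.length = n ∧ (g ^ n) x = (w.map f).prod x := by
    intro n x
    induction n with
    | zero => exact ⟨[], rfl, rfl⟩
    | succ n ih =>
      obtain ⟨w, hw, hgw⟩ := ih
      obtain ⟨i, hi⟩ := hfg ((g ^ n) x)
      refine ⟨i :: w, by rw [List.length_cons, hw], ?_⟩
      rw [pow_succ', CircleDeg1Lift.mul_apply, hi, hgw, List.map_cons, List.prod_cons,
        CircleDeg1Lift.mul_apply]
  rw [← CircleDeg1Lift.translationNumber_pow]
  refine CircleDeg1Lift.lt_translationNumber_of_forall_add_lt _ (g.continuous_pow hg n) fun x => ?_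
  obtain ⟨w, hw, hgw⟩ := exists_word n x
  rw [hgw]
  exact CircleDeg1Lift.lt_map_of_int_lt_translationNumber _ (h w hw) x

/-- The polar form `1 - ⟨P, Q⟩` of the unit circle. In the Klein model it is the Lorentz product of
the vectors `(1, P)` and `(1, Q)`. -/
def polar (P Q : ℂ) : ℝ := 1 - (P.re * Q.re + P.im * Q.im)

/-- Twice the signed area of the triangle `a b c`. -/
def signedArea (a b c : ℂ) : ℝ :=
  (b.re - a.re) * (c.im - a.im) - (b.im - a.im) * (c.re - a.re)

theorem polar_comm (P Q : ℂ) : polar P Q = polar Q P := by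
  rw [polar, polar, mul_comm P.re, mul_comm P.im]

theorem polar_self (P : ℂ) : polar P P = 1 - ‖P‖ ^ 2 := by
  rw [polar, Complex.sq_norm, Complex.normSq_apply]

theorem polar_self_pos {P : ℂ} (hP : ‖P‖ < 1) : 0 < polar P P := by
  rw [polar_self, sub_pos]
  exact pow_lt_one₀ (norm_nonneg P) hP two_ne_zero

theorem polar_lineMap_left (a b c : ℂ) (t : ℝ) :
    polar (AffineMap.lineMap a b t) c = (1 - t) * polar a c + t * polar b c := by
  simp only [polar, AffineMap.lineMap_apply_module, Complex.add_re, Complex.add_im,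
    Complex.smul_re, Complex.smul_im, smul_eq_mul]
  ring

theorem polar_lineMap_lineMap {v w : ℂ} (hv : ‖v‖ = 1) (hw : ‖w‖ = 1) (p q : ℝ) :
    polar (AffineMap.lineMap v w p) (AffineMap.lineMap v w q)
      = polar v w * (p * (1 - q) + q * (1 - p)) := by
  have hvv : polar v v = 0 := by rw [polar_self, hv]; norm_num
  have hww : polar w w = 0 := by rw [polar_self, hw]; norm_num
  rw [polar_lineMap_left, polar_comm v, polar_comm w, polar_lineMap_left, polar_lineMap_left, hvv,
    hww, polar_comm w v]
  ring

theorem sbtw_rayEnd {P Q : ℂ} (hP : ‖P‖ < 1) (hQ : ‖Q‖ < 1) (hne : P ≠ Q) :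
    Sbtw ℝ P Q (rayEnd P Q) := by
  obtain ⟨hnorm, s, hs, hend⟩ := (eq_rayEnd_iff hP hne).1 rfl
  have not_mem_ball : rayEnd P Q ∉ Metric.ball (0 : ℂ) 1 := by
    rw [mem_ball_zero_iff, hnorm]; exact lt_irrefl 1
  have hQend : Q ≠ rayEnd P Q := fun h => not_mem_ball (h ▸ mem_ball_zero_iff.2 hQ)
  have hline := wbtw_or_wbtw_smul_vadd_of_nonneg P (Q - P) zero_le_one hs
  rw [one_smul, vadd_eq_add, sub_add_cancel, vadd_eq_add, add_comm, ← hend] at hline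
  refine ⟨hline.resolve_right fun h => not_mem_ball ?_, hne.symm, hQend⟩
  exact (convex_ball 0 1).mem_of_wbtw h (mem_ball_zero_iff.2 hP) (mem_ball_zero_iff.2 hQ)

theorem exists_chord_parameters {P Q : ℂ} (hP : ‖P‖ < 1) (hQ : ‖Q‖ < 1) (hne : P ≠ Q) :
    ∃ p q : ℝ, 0 < p ∧ p < q ∧ q < 1 ∧ AffineMap.lineMap (rayEnd Q P) (rayEnd P Q) p = P ∧
      AffineMap.lineMap (rayEnd Q P) (rayEnd P Q) q = Q := by
  have hP_between := (sbtw_rayEnd hQ hP hne.symm).symm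
  have hQ_between := hP_between.trans_expand_right (sbtw_rayEnd hP hQ hne)
  obtain ⟨⟨r, ⟨hr0, hr1⟩, hr⟩, -⟩ := sbtw_iff_mem_image_Ioo_and_ne.1 hP_between
  obtain ⟨⟨q, ⟨hq0, hq1⟩, hq⟩, -⟩ := sbtw_iff_mem_image_Ioo_and_ne.1 hQ_between
  refine ⟨r * q, q, mul_pos hr0 hq0, mul_lt_of_lt_one_left hq0 hr1, hq1, ?_, hq⟩
  rw [← AffineMap.lineMap_lineMap_right, hq, hr]

theorem two_mul_dist' {P Q : ℂ} {p q : ℝ} (hne : P ≠ Q) (hp : 0 < p) (hpq : p < q) (hq : q < 1)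
    (hP : AffineMap.lineMap (rayEnd Q P) (rayEnd P Q) p = P)
    (hQ : AffineMap.lineMap (rayEnd Q P) (rayEnd P Q) q = Q) :
    2 * dist' P Q = Real.log (q * (1 - p) / (p * (1 - q))) := by
  have hp1 : 0 < 1 - p := by linarith
  have hq1 : 0 < 1 - q := by linarith
  have hq0 : 0 < q := hp.trans hpq
  rw [dist']
  generalize rayEnd Q P = v at *
  generalize rayEnd P Q = w at *
  have hvw : dist v w ≠ 0 := by
    rw [dist_ne_zero]
    rintro rfl
    rw [AffineMap.lineMap_same_apply] at hP hQ
    exact hne (hP.symm.trans hQ)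
  have hvP : ‖v - P‖ = p * dist v w := by
    rw [← dist_eq_norm, ← hP, dist_left_lineMap, Real.norm_of_nonneg hp.le]
  have hvQ : ‖v - Q‖ = q * dist v w := by
    rw [← dist_eq_norm, ← hQ, dist_left_lineMap, Real.norm_of_nonneg hq0.le]
  have hwP : ‖w - P‖ = (1 - p) * dist v w := by
    rw [← dist_eq_norm, ← hP, dist_right_lineMap, Real.norm_of_nonneg hp1.le]
  have hwQ : ‖w - Q‖ = (1 - q) * dist v w := by
    rw [← dist_eq_norm, ← hQ, dist_right_lineMap, Real.norm_of_nonneg hq1.le]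
  have hratio : ‖v - Q‖ * ‖w - P‖ / (‖v - P‖ * ‖w - Q‖) = q * (1 - p) / (p * (1 - q)) := by
    rw [hvP, hvQ, hwP, hwQ]
    field_simp
  have one_le : 1 ≤ q * (1 - p) / (p * (1 - q)) := by
    rw [one_le_div (by positivity)]
    linarith
  rw [hratio, abs_of_nonneg (Real.log_nonneg one_le)]
  ring

theorem dist'_nonneg (P Q : ℂ) : 0 ≤ dist' P Q :=
  mul_nonneg one_half_pos.le (abs_nonneg _)

theorem dist'_pos {P Q : ℂ} (hP : ‖P‖ < 1) (hQ : ‖Q‖ < 1) (hne : P ≠ Q) : 0 < dist' P Q := by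
  obtain ⟨p, q, hp, hpq, hq, hPp, hQq⟩ := exists_chord_parameters hP hQ hne
  have h : 0 < 2 * dist' P Q := by
    rw [two_mul_dist' hne hp hpq hq hPp hQq]
    refine Real.log_pos ?_
    rw [one_lt_div (mul_pos hp (sub_pos.2 hq))]
    linarith
  linarith

theorem cosh_dist'_sq_mul {P Q : ℂ} (hP : ‖P‖ < 1) (hQ : ‖Q‖ < 1) :
    Real.cosh (dist' P Q) ^ 2 * (polar P P * polar Q Q) = polar P Q ^ 2 := by
  rcases eq_or_ne P Q with rfl | hne
  · rw [dist'_self, Real.cosh_zero]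
    ring
  obtain ⟨p, q, hp, hpq, hq, hPp, hQq⟩ := exists_chord_parameters hP hQ hne
  have hq0 : 0 < q := hp.trans hpq
  have hp1 : 0 < 1 - p := by linarith
  have hq1 : 0 < 1 - q := by linarith
  have hcosh : Real.cosh (dist' P Q) ^ 2 =
      (p * (1 - q) + q * (1 - p)) ^ 2 / (4 * (p * (1 - q)) * (q * (1 - p))) := by
    have half_angle : Real.cosh (dist' P Q) ^ 2 = (Real.cosh (2 * dist' P Q) + 1) / 2 := by
      rw [Real.cosh_two_mul, Real.sinh_sq]
      ring
    rw [half_angle, two_mul_dist' hne hp hpq hq hPp hQq, Real.cosh_log (by positivity)]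
    field_simp
    ring
  have hpolar := polar_lineMap_lineMap ((eq_rayEnd_iff hQ hne.symm).1 rfl).1
    ((eq_rayEnd_iff hP hne).1 rfl).1
  have hPP := hpolar p p
  have hQQ := hpolar q q
  have hPQ := hpolar p q
  rw [hPp] at hPP hPQ
  rw [hQq] at hQQ hPQ
  rw [hcosh, hPP, hQQ, hPQ]
  field_simp
  ring

theorem sinh_dist'_sq_mul {P Q : ℂ} (hP : ‖P‖ < 1) (hQ : ‖Q‖ < 1) :
    Real.sinh (dist' P Q) ^ 2 * (polar P P * polar Q Q)
      = polar P Q ^ 2 - polar P P * polar Q Q := by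
  rw [Real.sinh_sq, ← cosh_dist'_sq_mul hP hQ]
  ring

theorem polar_self_mul_polar_self_le {P Q : ℂ} (hP : ‖P‖ < 1) (hQ : ‖Q‖ < 1) :
    polar P P * polar Q Q ≤ polar P Q ^ 2 := by
  have := mul_pos (polar_self_pos hP) (polar_self_pos hQ)
  rw [← sub_nonneg, ← sinh_dist'_sq_mul hP hQ]
  positivity

theorem sinh_Delta' {n : ℕ} {P Q : ℂ} (h : 0 < n * dist' P Q) :
    Real.sinh (Delta' n P Q) = (Real.sinh (n * dist' P Q))⁻¹ := by
  have hexp : 0 < Real.exp (n * dist' P Q) - 1 := sub_pos.2 (Real.one_lt_exp_iff.2 h)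
  have hsq : 0 < Real.exp (n * dist' P Q) ^ 2 - 1 := by nlinarith
  rw [Delta', Real.sinh_log (by positivity), Real.sinh_eq, Real.exp_neg]
  field_simp
  ring

theorem exists_dist'_lt_of_delta_lt {a b c : ℂ} {r : ℝ} (ha : ‖a‖ < 1) (h : delta a b c < r) :
    ∃ s ∈ line[ℝ, a, b], ‖s‖ < 1 ∧ dist' c s < r := by
  have nonempty : {r | ∃ s, s ∈ line[ℝ, a, b] ∧ ‖s‖ < 1 ∧ r = dist' c s}.Nonempty :=
    ⟨_, a, left_mem_affineSpan_pair ℝ a b, ha, rfl⟩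
  obtain ⟨_, ⟨s, hs, hs1, rfl⟩, hlt⟩ := exists_lt_of_csInf_lt nonempty h
  exact ⟨s, hs, hs1, hlt⟩

/-- Among the points of the line `a b`, the foot of the perpendicular from `c` minimizes the
hyperbolic distance to `c`; the difference of the two sides is a square that vanishes there. -/
theorem signedArea_sq_mul_le {a b c s : ℂ} (hs : s ∈ line[ℝ, a, b]) :
    signedArea a b c ^ 2 * polar s s ≤
      (polar c s ^ 2 - polar c c * polar s s) * (polar a b ^ 2 - polar a a * polar b b) := by
  obtain ⟨t, rfl⟩ := mem_affineSpan_pair_iff_exists_lineMap_eq.1 hs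
  set s := AffineMap.lineMap a b t with hs
  have hre : s.re = (1 - t) * a.re + t * b.re := by
    simp only [hs, AffineMap.lineMap_apply_module, Complex.add_re, Complex.smul_re, smul_eq_mul]
  have him : s.im = (1 - t) * a.im + t * b.im := by
    simp only [hs, AffineMap.lineMap_apply_module, Complex.add_im, Complex.smul_im, smul_eq_mul]
  have hsq : (polar c s ^ 2 - polar c c * polar s s) * (polar a b ^ 2 - polar a a * polar b b)
      - signedArea a b c ^ 2 * polar s s =
      (polar c s * (polar b s - polar a s) - (polar c b - polar c a) * polar s s) ^ 2 := by
    simp only [polar, signedArea, hre, him]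
    ring
  rw [← sub_nonneg, hsq]
  positivity

theorem four_mul_polar_sq_mul_signedArea_sq_lt {a b c : ℂ} (ha : ‖a‖ < 1) (hb : ‖b‖ < 1)
    (hc : ‖c‖ < 1) (hab : a ≠ b) (h : delta a b c < Delta' 2 a b) :
    4 * polar a b ^ 2 * signedArea a b c ^ 2 < (polar a a * polar b b) ^ 2 * polar c c := by
  obtain ⟨s, hs, hs1, hlt⟩ := exists_dist'_lt_of_delta_lt ha h
  have hd : 0 < 2 * dist' a b := mul_pos two_pos (dist'_pos ha hb hab)
  have hsinh : Real.sinh (dist' c s) ^ 2 * Real.sinh (2 * dist' a b) ^ 2 < 1 := by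
    have hsinh_lt := Real.sinh_lt_sinh.2 hlt
    rw [sinh_Delta' (mod_cast hd), Nat.cast_ofNat, ← one_div,
      lt_div_iff₀ (Real.sinh_pos_iff.2 hd)] at hsinh_lt
    rw [← mul_pow]
    exact pow_lt_one₀ (mul_nonneg (Real.sinh_nonneg_iff.2 (dist'_nonneg c s))
      (Real.sinh_nonneg_iff.2 hd.le)) hsinh_lt two_ne_zero
  have hsinh_two : Real.sinh (2 * dist' a b) ^ 2 * (polar a a * polar b b) ^ 2
      = 4 * polar a b ^ 2 * (polar a b ^ 2 - polar a a * polar b b) := by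
    rw [← sinh_dist'_sq_mul ha hb, ← cosh_dist'_sq_mul ha hb, Real.sinh_two_mul]
    ring
  have hss := polar_self_pos hs1
  have hmul : 0 < polar c c * polar s s * (polar a a * polar b b) ^ 2 :=
    mul_pos (mul_pos (polar_self_pos hc) hss)
      (pow_pos (mul_pos (polar_self_pos ha) (polar_self_pos hb)) 2)
  refine lt_of_mul_lt_mul_right ?_ hss.le
  calc 4 * polar a b ^ 2 * signedArea a b c ^ 2 * polar s s
      = 4 * polar a b ^ 2 * (signedArea a b c ^ 2 * polar s s) := by ring
    _ ≤ 4 * polar a b ^ 2 *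
        ((polar c s ^ 2 - polar c c * polar s s) * (polar a b ^ 2 - polar a a * polar b b)) := by
      exact mul_le_mul_of_nonneg_left (signedArea_sq_mul_le hs) (by positivity)
    _ = Real.sinh (dist' c s) ^ 2 * Real.sinh (2 * dist' a b) ^ 2 *
        (polar c c * polar s s * (polar a a * polar b b) ^ 2) := by
      rw [← sinh_dist'_sq_mul hc hs1]
      linear_combination - Real.sinh (dist' c s) ^ 2 * (polar c c * polar s s) * hsinh_two
    _ < polar c c * polar s s * (polar a a * polar b b) ^ 2 := mul_lt_of_lt_one_left hmul hsinh
    _ = (polar a a * polar b b) ^ 2 * polar c c * polar s s := by ring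

theorem signedArea_sq_lt {a b c : ℂ} (ha : ‖a‖ < 1) (hb : ‖b‖ < 1)
    (h : 4 * polar a b ^ 2 * signedArea a b c ^ 2 < (polar a a * polar b b) ^ 2 * polar c c) :
    signedArea a b c ^ 2 < polar a a * polar b b * polar c c := by
  have hpos := mul_pos (polar_self_pos ha) (polar_self_pos hb)
  refine lt_of_mul_lt_mul_left ?_ hpos.le
  calc polar a a * polar b b * signedArea a b c ^ 2
      ≤ polar a b ^ 2 * signedArea a b c ^ 2 := by
        gcongr
        exact polar_self_mul_polar_self_le ha hb
    _ ≤ 4 * polar a b ^ 2 * signedArea a b c ^ 2 := by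
        rw [mul_assoc]
        exact le_mul_of_one_le_left (by positivity) (by norm_num)
    _ < (polar a a * polar b b) ^ 2 * polar c c := h
    _ = polar a a * polar b b * (polar a a * polar b b * polar c c) := by ring

open ComplexConjugate Real

/-- A lift to `ℝ` of the map `psi U`. For `U = {u}` this is the half-turn about `u`, which exchanges
the two ends of every chord through `u`. -/
noncomputable def psiLift (U : Set ℂ) (x : ℝ) : ℝ :=
  x + 1 / 2 + arctan (minGradient U (proj x)) / π

theorem proj_add_one (x : ℝ) : proj (x + 1) = proj x :=
  proj_eq_iff.2 ⟨1, by rw [Int.cast_one]⟩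

theorem continuous_proj : Continuous proj := by
  unfold proj
  fun_prop

section Lift

variable (U : Set ℂ) (x : ℝ)

theorem psiLift_add_one : psiLift U (x + 1) = psiLift U x + 1 := by
  rw [psiLift, proj_add_one, psiLift]
  ring

theorem proj_psiLift : proj (psiLift U x) = psi U (proj x) := by
  rw [psi, psiLift]
  generalize arctan (minGradient U (proj x)) = a
  rw [proj, proj, ← Circle.exp_add]
  congr 1
  field_simp
  ring

theorem lt_psiLift : x < psiLift U x := by
  have h := div_lt_div_of_pos_right (neg_pi_div_two_lt_arctan (minGradient U (proj x))) pi_pos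
  rw [neg_div, div_div_cancel_left' pi_ne_zero] at h
  rw [psiLift]
  linarith

theorem psiLift_lt_add_one : psiLift U x < x + 1 := by
  have h := div_lt_div_of_pos_right (arctan_lt_pi_div_two (minGradient U (proj x))) pi_pos
  rw [div_div_cancel_left' pi_ne_zero] at h
  rw [psiLift]
  linarith

end Lift

theorem minGradient_singleton (u : ℂ) (v : Circle) : minGradient {u} v = gradient v u := by
  rw [minGradient, Set.image_singleton, csInf_singleton]

theorem conj_coe_mul_self (v : Circle) : conj (v : ℂ) * v = 1 := by
  rw [← Complex.normSq_eq_conj_mul_self, Circle.normSq_coe, Complex.ofReal_one]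

theorem exp_two_mul_arctan_mul_conj {z : ℂ} (hz : z.re ≠ 0) :
    Complex.exp ((2 * arctan (z.im / z.re) : ℝ) * Complex.I) * conj z = z := by
  set a := arctan (z.im / z.re)
  have htan : (sin a * z.re : ℂ) = z.im * cos a := by
    rw_mod_cast [← div_eq_div_iff (cos_arctan_pos _).ne' hz, ← tan_eq_sin_div_cos, tan_arctan]
  have hconj : conj z = z.re - z.im * Complex.I := by
    rw [← Complex.re_add_im (conj z), Complex.conj_re, Complex.conj_im, Complex.ofReal_neg]
    ring
  have reflect : Complex.exp (a * Complex.I) * conj z = Complex.exp (-(a * Complex.I)) * z := by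
    rw [← neg_mul, ← Complex.ofReal_neg, Complex.exp_ofReal_mul_I, Complex.exp_ofReal_mul_I,
      cos_neg, sin_neg, Complex.ofReal_neg, hconj]
    linear_combination 2 * Complex.I * htan + (cos a - sin a * Complex.I) * Complex.re_add_im z
  calc Complex.exp ((2 * a : ℝ) * Complex.I) * conj z
      = Complex.exp (a * Complex.I) * (Complex.exp (a * Complex.I) * conj z) := by
        rw [← mul_assoc, ← Complex.exp_add, Complex.ofReal_mul, Complex.ofReal_ofNat, mul_assoc,
          two_mul]
    _ = z := by
        rw [reflect, ← mul_assoc, ← Complex.exp_add, add_neg_cancel, Complex.exp_zero, one_mul]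

section Point

variable {u : ℂ} (hu : ‖u‖ < 1)
include hu

theorem re_sub_div_neg (v : Circle) : ((u - v) / v).re < 0 := by
  rw [sub_div, div_self v.coe_ne_zero, Complex.sub_re, Complex.one_re, sub_neg]
  calc (u / v).re ≤ ‖u / v‖ := Complex.re_le_norm _
    _ = ‖u‖ := by rw [norm_div, Circle.norm_coe, div_one]
    _ < 1 := hu

theorem one_sub_conj_mul_ne_zero (v : Circle) : 1 - conj u * v ≠ 0 := fun h => by
  have hnorm : ‖conj u * (v : ℂ)‖ = 1 := by rw [← sub_eq_zero.1 h, norm_one]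
  rw [norm_mul, Complex.norm_conj, Circle.norm_coe, mul_one] at hnorm
  exact hu.ne hnorm

theorem psi_singleton_mul (v : Circle) : (psi {u} v : ℂ) * (1 - conj u * v) = u - v := by
  have hv := v.coe_ne_zero
  set z : ℂ := (u - v) / v with hz
  have hconj : conj z = conj u * v - 1 := by
    rw [hz, map_div₀, map_sub, div_eq_iff ((map_ne_zero conj).2 hv)]
    linear_combination -conj u * conj_coe_mul_self v
  have hpsi : (psi {u} v : ℂ) =
      -(v * Complex.exp ((2 * arctan (z.im / z.re) : ℝ) * Complex.I)) := by
    rw [psi, minGradient_singleton, gradient, ← hz, Circle.coe_mul, Circle.coe_exp,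
      Complex.ofReal_add, add_mul, Complex.exp_add, Complex.exp_pi_mul_I]
    ring
  calc (psi {u} v : ℂ) * (1 - conj u * v)
      = v * (Complex.exp ((2 * arctan (z.im / z.re) : ℝ) * Complex.I) * conj z) := by
        rw [hpsi, hconj]
        ring
    _ = u - v := by
        rw [exp_two_mul_arctan_mul_conj (re_sub_div_neg hu v).ne, mul_div_cancel₀ _ hv]

theorem continuous_psiLift_singleton : Continuous (psiLift {u}) := by
  have hquot : Continuous fun x => (u - proj x) / (proj x : ℂ) := by
    have := continuous_subtype_val.comp continuous_proj
    exact (continuous_const.sub this).div this fun x => (proj x).coe_ne_zero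
  have hgrad : Continuous fun x => minGradient {u} (proj x) := by
    simp only [minGradient_singleton, gradient]
    exact (Complex.continuous_im.comp hquot).div (Complex.continuous_re.comp hquot)
      fun x => (re_sub_div_neg hu _).ne
  unfold psiLift
  fun_prop

theorem psi_singleton_psi_singleton (v : Circle) : psi {u} (psi {u} v) = v := by
  ext1
  refine mul_right_cancel₀ (one_sub_conj_mul_ne_zero hu (psi {u} v)) ?_
  linear_combination psi_singleton_mul hu (psi {u} v) - psi_singleton_mul hu v

theorem psiLift_singleton_psiLift_singleton (x : ℝ) : psiLift {u} (psiLift {u} x) = x + 1 := by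
  have hproj : proj (psiLift {u} (psiLift {u} x)) = proj x := by
    rw [proj_psiLift, proj_psiLift, psi_singleton_psi_singleton hu]
  obtain ⟨n, hn⟩ := proj_eq_iff.1 hproj
  have hpos : (0 : ℝ) < n := by linarith [lt_psiLift {u} x, lt_psiLift {u} (psiLift {u} x)]
  have hlt : (n : ℝ) < 2 := by
    linarith [psiLift_lt_add_one {u} x, psiLift_lt_add_one {u} (psiLift {u} x)]
  norm_cast at hpos hlt
  rw [hn, show n = 1 by lia, Int.cast_one]

theorem strictMono_psiLift_singleton : StrictMono (psiLift {u}) := by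
  have hinj : Function.Injective (psiLift {u}) := fun x y hxy => by
    have := congrArg (psiLift {u}) hxy
    rwa [psiLift_singleton_psiLift_singleton hu, psiLift_singleton_psiLift_singleton hu,
      add_left_inj] at this
  refine ((continuous_psiLift_singleton hu).strictMono_of_inj hinj).resolve_right fun h => ?_
  have := h (lt_add_one (0 : ℝ))
  rw [psiLift_add_one] at this
  exact this.not_ge (le_add_of_nonneg_right zero_le_one)

end Point

/-- The half-turn about the point `u` of the disk, as a lift. -/
noncomputable def halfTurnLift (u : ℂ) (hu : ‖u‖ < 1) : CircleDeg1Lift where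
  toFun := psiLift {u}
  monotone' := (strictMono_psiLift_singleton hu).monotone
  map_add_one' := psiLift_add_one {u}

theorem halfTurnLift_apply {u : ℂ} (hu : ‖u‖ < 1) (x : ℝ) :
    halfTurnLift u hu x = psiLift {u} x := rfl

section ConvexHull

theorem minGradient_convexHull {U : Set ℂ} {v : Circle} {u₀ : ℂ} (hU : ∀ u ∈ U, ‖u‖ < 1)
    (hu₀ : u₀ ∈ U) (hmin : ∀ u ∈ U, gradient v u₀ ≤ gradient v u) :
    minGradient (convexHull ℝ U) v = gradient v u₀ := by
  set m := gradient v u₀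
  have isLinear : IsLinearMap ℝ fun u : ℂ => (u / v).im - m * (u / v).re := by
    constructor
    · intro x y
      simp only [add_div, Complex.add_im, Complex.add_re]
      ring
    · intro c x
      simp only [smul_div_assoc, Complex.smul_im, Complex.smul_re, smul_eq_mul]
      ring
  have le_gradient_iff : ∀ {u : ℂ}, ‖u‖ < 1 →
      (m ≤ gradient v u ↔ (u / v).im - m * (u / v).re ≤ -m) := fun {u} hu => by
    rw [gradient, le_div_iff_of_neg (re_sub_div_neg hu v), sub_div, div_self v.coe_ne_zero,
      Complex.sub_im, Complex.sub_re, Complex.one_re, Complex.one_im]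
    constructor <;> intro h <;> linarith
  have norm_lt : ∀ u ∈ convexHull ℝ U, ‖u‖ < 1 := fun u hu =>
    mem_ball_zero_iff.1 (convexHull_min (fun u hu => mem_ball_zero_iff.2 (hU u hu))
      (convex_ball 0 1) hu)
  refine IsLeast.csInf_eq ⟨⟨u₀, subset_convexHull ℝ U hu₀, rfl⟩, ?_⟩
  rintro _ ⟨u, hu, rfl⟩
  exact (le_gradient_iff (norm_lt u hu)).2 (convexHull_min
    (fun u hu => (le_gradient_iff (hU u hu)).1 (hmin u hu)) (convex_halfSpace_le isLinear _) hu)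

variable {ι : Type*} [Finite ι] [Nonempty ι] {P : ι → ℂ} (hP : ∀ i, ‖P i‖ < 1)
include hP

theorem isLeast_psiLift_convexHull (x : ℝ) :
    IsLeast (Set.range fun i => psiLift {P i} x) (psiLift (convexHull ℝ (Set.range P)) x) := by
  obtain ⟨i, hi⟩ := Finite.exists_min fun i => gradient (proj x) (P i)
  have hmin : minGradient (convexHull ℝ (Set.range P)) (proj x) = gradient (proj x) (P i) :=
    minGradient_convexHull (Set.forall_mem_range.2 hP) ⟨i, rfl⟩ (Set.forall_mem_range.2 hi)
  simp only [psiLift, minGradient_singleton, hmin]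
  refine ⟨⟨i, rfl⟩, Set.forall_mem_range.2 fun j => ?_⟩
  gcongr
  exact hi j

theorem strictMono_psiLift_convexHull : StrictMono (psiLift (convexHull ℝ (Set.range P))) := by
  intro x y hxy
  obtain ⟨i, hi⟩ := (isLeast_psiLift_convexHull hP y).1
  rw [← hi]
  exact ((isLeast_psiLift_convexHull hP x).2 ⟨i, rfl⟩).trans_lt
    (strictMono_psiLift_singleton (hP i) hxy)

theorem continuous_psiLift_convexHull : Continuous (psiLift (convexHull ℝ (Set.range P))) := by
  cases nonempty_fintype ι
  have eq_inf' : psiLift (convexHull ℝ (Set.range P)) =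
      fun x => Finset.univ.inf' Finset.univ_nonempty fun i => psiLift {P i} x := by
    funext x
    obtain ⟨⟨i, hi⟩, hle⟩ := isLeast_psiLift_convexHull hP x
    refine le_antisymm (Finset.le_inf' _ _ fun j _ => hle ⟨j, rfl⟩) ?_
    rw [← hi]
    exact Finset.inf'_le _ (Finset.mem_univ i)
  rw [eq_inf']
  exact .finset_inf'_apply _ fun i _ => continuous_psiLift_singleton (hP i)

theorem exists_isNormalizedLift_psi_convexHull :
    ∃ g, IsNormalizedLift (psi (convexHull ℝ (Set.range P))) g ∧
      ∀ x, g x = psiLift (convexHull ℝ (Set.range P)) x :=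
  ⟨{ toFun := psiLift (convexHull ℝ (Set.range P))
     monotone' := (strictMono_psiLift_convexHull hP).monotone
     map_add_one' := psiLift_add_one _ },
   { continuous := continuous_psiLift_convexHull hP
     strictMono := strictMono_psiLift_convexHull hP
     semiconj := proj_psiLift _
     map_zero_mem := ⟨(lt_psiLift _ 0).le, (psiLift_lt_add_one _ 0).trans_eq (zero_add 1)⟩ },
   fun _ => rfl⟩

end ConvexHull

section Matrix

open Matrix

/-- The half-turn about `u` as a Möbius transformation: `v ↦ (u - v) / (1 - conj u * v)`, scaled by
`I` so that the second row is conjugate to the first one read backwards. -/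
noncomputable def halfTurnMatrix (u : ℂ) : Matrix (Fin 2) (Fin 2) ℂ :=
  !![-Complex.I, Complex.I * u; -Complex.I * conj u, Complex.I]

/-- `f` is a continuous lift of the Möbius transformation of the circle with matrix `M`, where `M`
has the form `!![α, β; conj β, conj α]` of a scaled element of `SU(1, 1)`. -/
structure IsMobiusLift (M : Matrix (Fin 2) (Fin 2) ℂ) (f : CircleDeg1Lift) : Prop where
  one_one_eq_conj : M 1 1 = conj (M 0 0)
  one_zero_eq_conj : M 1 0 = conj (M 0 1)
  continuous : Continuous f
  proj_mul_eq : ∀ x, (proj (f x) : ℂ) * (M 1 0 * proj x + M 1 1) = M 0 0 * proj x + M 0 1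

namespace IsMobiusLift

variable {M N : Matrix (Fin 2) (Fin 2) ℂ} {f g : CircleDeg1Lift}

theorem mul (hf : IsMobiusLift M f) (hg : IsMobiusLift N g) : IsMobiusLift (M * N) (f * g) where
  one_one_eq_conj := by
    rw [mul_apply, mul_apply, Fin.sum_univ_two, Fin.sum_univ_two, map_add, map_mul, map_mul,
      hf.one_one_eq_conj, hf.one_zero_eq_conj, hg.one_one_eq_conj, hg.one_zero_eq_conj,
      Complex.conj_conj, add_comm]
  one_zero_eq_conj := by
    rw [mul_apply, mul_apply, Fin.sum_univ_two, Fin.sum_univ_two, map_add, map_mul, map_mul,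
      hf.one_one_eq_conj, hf.one_zero_eq_conj, hg.one_one_eq_conj, hg.one_zero_eq_conj,
      Complex.conj_conj, add_comm]
  continuous := hf.continuous.comp hg.continuous
  proj_mul_eq x := by
    have h := hg.proj_mul_eq x
    simp only [mul_apply, Fin.sum_univ_two, CircleDeg1Lift.mul_apply]
    linear_combination (N 1 0 * proj x + N 1 1) * hf.proj_mul_eq (g x)
      + (M 0 0 - M 1 0 * proj (f (g x))) * h

theorem four_mul_det_le_of_fixed (hf : IsMobiusLift M f) {x : ℝ} (hx : proj (f x) = proj x) :
    4 * M.det.re ≤ M.trace.re ^ 2 := by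
  have hfix := hf.proj_mul_eq x
  rw [hx] at hfix
  generalize proj x = v at hfix
  rw [hf.one_one_eq_conj, hf.one_zero_eq_conj] at hfix
  rw [det_fin_two, trace_fin_two, hf.one_one_eq_conj, hf.one_zero_eq_conj]
  generalize M 0 0 = α at *
  generalize M 0 1 = β at *
  have him : α.im = -(β * conj (v : ℂ)).im := by
    have h : α - conj α = -(β * conj (v : ℂ) - conj (β * conj (v : ℂ))) := by
      rw [map_mul, Complex.conj_conj]
      linear_combination -conj (v : ℂ) * hfix
        + (conj β * v + conj α - α) * conj_coe_mul_self v
    have h_im := congrArg Complex.im h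
    simp only [Complex.sub_im, Complex.neg_im, Complex.conj_im] at h_im
    linarith
  have hnormSq : α.im ^ 2 ≤ Complex.normSq β := by
    rw [him, neg_sq]
    calc (β * conj (v : ℂ)).im ^ 2 ≤ Complex.normSq (β * conj (v : ℂ)) := by
          rw [sq]
          exact Complex.im_sq_le_normSq _
      _ = Complex.normSq β := by
          rw [map_mul, Complex.normSq_conj, Circle.normSq_coe, mul_one]
  rw [Complex.mul_conj, Complex.mul_conj, Complex.sub_re, Complex.ofReal_re, Complex.ofReal_re,
    Complex.add_re, Complex.conj_re, Complex.normSq_apply α]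
  linarith

theorem translationNumber_ne (hf : IsMobiusLift M f) (h : M.trace.re ^ 2 < 4 * M.det.re) (m : ℤ) :
    f.translationNumber ≠ m := by
  rw [ne_eq, CircleDeg1Lift.translationNumber_eq_int_iff f hf.continuous]
  rintro ⟨x, hx⟩
  exact h.not_ge (hf.four_mul_det_le_of_fixed (proj_eq_iff.2 ⟨m, hx⟩))

end IsMobiusLift

theorem isMobiusLift_halfTurnLift {u : ℂ} (hu : ‖u‖ < 1) :
    IsMobiusLift (halfTurnMatrix u) (halfTurnLift u hu) where
  one_one_eq_conj := by simp [halfTurnMatrix]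
  one_zero_eq_conj := by simp [halfTurnMatrix]
  continuous := continuous_psiLift_singleton hu
  proj_mul_eq x := by
    rw [halfTurnLift_apply, proj_psiLift]
    simp only [halfTurnMatrix, of_apply, cons_val_zero, cons_val_one]
    linear_combination Complex.I * psi_singleton_mul hu (proj x)

theorem det_halfTurnMatrix (u : ℂ) : (halfTurnMatrix u).det = polar u u := by
  rw [halfTurnMatrix, det_fin_two_of, polar_self, Complex.ofReal_sub, Complex.ofReal_pow,
    ← Complex.mul_conj', Complex.ofReal_one]
  linear_combination (u * conj u - 1) * Complex.I_mul_I

theorem two_mul_coe_polar (a b : ℂ) : (2 * polar a b : ℂ) = 2 - (a * conj b + conj a * b) := by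
  have hpolar : polar a b = 1 - (a * conj b).re := by
    rw [polar, Complex.mul_re, Complex.conj_re, Complex.conj_im]
    ring
  have hre := Complex.add_conj (a * conj b)
  rw [map_mul, Complex.conj_conj] at hre
  rw [hre, hpolar]
  push_cast
  ring

theorem two_mul_I_mul_coe_signedArea (a b c : ℂ) :
    2 * Complex.I * signedArea a b c = conj (b - a) * (c - a) - (b - a) * conj (c - a) := by
  have harea : signedArea a b c = (conj (b - a) * (c - a)).im := by
    rw [signedArea, Complex.mul_im, Complex.conj_re, Complex.conj_im]
    simp only [Complex.sub_re, Complex.sub_im]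
    ring
  have him := Complex.sub_conj (conj (b - a) * (c - a))
  rw [map_mul, Complex.conj_conj] at him
  rw [him, harea]
  push_cast
  ring

theorem trace_halfTurnMatrix_mul (a b : ℂ) :
    (halfTurnMatrix a * halfTurnMatrix b).trace = (-2 * polar a b : ℝ) := by
  rw [halfTurnMatrix, halfTurnMatrix, mul_fin_two, trace_fin_two_of]
  push_cast
  linear_combination 2 * polar a b * Complex.I_mul_I - Complex.I ^ 2 * two_mul_coe_polar a b

theorem trace_halfTurnMatrix_mul_mul (a b c : ℂ) :
    (halfTurnMatrix a * halfTurnMatrix b * halfTurnMatrix c).trace =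
      (-2 * signedArea a b c : ℝ) := by
  have harea := two_mul_I_mul_coe_signedArea a b c
  rw [map_sub, map_sub] at harea
  rw [halfTurnMatrix, halfTurnMatrix, halfTurnMatrix, mul_fin_two, mul_fin_two, trace_fin_two_of]
  push_cast
  linear_combination Complex.I ^ 3 * harea
    - 2 * signedArea a b c * (Complex.I ^ 2 - 1) * Complex.I_mul_I

theorem trace_mul_self_mul {R : Type*} [CommRing R] (M N : Matrix (Fin 2) (Fin 2) R) :
    (M * M * N).trace = M.trace * (M * N).trace - M.det * N.trace := by
  simp only [trace_fin_two, det_fin_two, mul_apply, Fin.sum_univ_two]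
  ring

theorem trace_halfTurnMatrix (u : ℂ) : (halfTurnMatrix u).trace = 0 := by
  rw [halfTurnMatrix, trace_fin_two_of, neg_add_cancel]

variable {a b c : ℂ} (ha : ‖a‖ < 1) (hb : ‖b‖ < 1) (hc : ‖c‖ < 1)

theorem translationNumber_halfTurnLift_mul_mul_ne
    (h : signedArea a b c ^ 2 < polar a a * polar b b * polar c c) :
    (halfTurnLift a ha * halfTurnLift b hb * halfTurnLift c hc).translationNumber ≠ 1 := by
  have hlift := ((isMobiusLift_halfTurnLift ha).mul (isMobiusLift_halfTurnLift hb)).mul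
    (isMobiusLift_halfTurnLift hc)
  refine mod_cast hlift.translationNumber_ne ?_ 1
  rw [trace_halfTurnMatrix_mul_mul, Complex.ofReal_re]
  simp only [det_mul, det_halfTurnMatrix, ← Complex.ofReal_mul, Complex.ofReal_re]
  linarith

theorem translationNumber_halfTurnLift_mul_mul_self_mul_ne
    (h : 4 * polar a b ^ 2 * signedArea a b c ^ 2 < (polar a a * polar b b) ^ 2 * polar c c) :
    (halfTurnLift a ha * halfTurnLift b hb * (halfTurnLift a ha * halfTurnLift b hb) *
      halfTurnLift c hc).translationNumber ≠ 2 := by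
  have hab := (isMobiusLift_halfTurnLift ha).mul (isMobiusLift_halfTurnLift hb)
  refine mod_cast ((hab.mul hab).mul (isMobiusLift_halfTurnLift hc)).translationNumber_ne ?_ 2
  rw [trace_mul_self_mul, trace_halfTurnMatrix, mul_zero, sub_zero, trace_halfTurnMatrix_mul,
    trace_halfTurnMatrix_mul_mul]
  simp only [det_mul, det_halfTurnMatrix, ← Complex.ofReal_mul, Complex.ofReal_re]
  linarith

end Matrix

theorem isHalfTurn_halfTurnLift {u : ℂ} (hu : ‖u‖ < 1) : IsHalfTurn (halfTurnLift u hu) :=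
  psiLift_singleton_psiLift_singleton hu

theorem lt_mul_rotationNumber_psi {ι : Type*} [Finite ι] [Nonempty ι] {P : ι → ℂ}
    (hP : ∀ i, ‖P i‖ < 1) {m : ℤ} {n : ℕ}
    (h : ∀ w : List ι, w.length = n →
      m < (w.map fun i => halfTurnLift (P i) (hP i)).prod.translationNumber) :
    m < n * rotationNumber (psi (convexHull ℝ (Set.range P))) := by
  obtain ⟨g, hg, hg_apply⟩ := exists_isNormalizedLift_psi_convexHull hP
  rw [hg.rotationNumber_eq]
  refine lt_mul_translationNumber_of_words hg.continuous (fun x => ?_) h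
  obtain ⟨i, hi⟩ := (isLeast_psiLift_convexHull hP x).1
  exact ⟨i, (hg_apply x).trans hi.symm⟩

end BarBilliard

theorem theorem5p3 (P : Fin 3 → ℂ) (hD : ∀ i, ‖P i‖ < 1) (hP : AffineIndependent ℝ P)
    (h : ∀ i j k : Fin 3, i ≠ j → i ≠ k → j ≠ k →
      BarBilliard.Delta' 2 (P i) (P j) > BarBilliard.delta (P i) (P j) (P k)) :
    BarBilliard.rotationNumber (BarBilliard.psi (convexHull ℝ (Set.range P))) > 2 / 5 := by
  open BarBilliard in
  have area_lt : ∀ i j k, i ≠ j → i ≠ k → j ≠ k →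
      4 * polar (P i) (P j) ^ 2 * signedArea (P i) (P j) (P k) ^ 2
        < (polar (P i) (P i) * polar (P j) (P j)) ^ 2 * polar (P k) (P k) :=
    fun i j k hij hik hjk => four_mul_polar_sq_mul_signedArea_sq_lt (hD i) (hD j) (hD k)
      (hP.injective.ne hij) (h i j k hij hik hjk)
  have three_ne_one := fun i j k hij hik hjk =>
    translationNumber_halfTurnLift_mul_mul_ne (hD i) (hD j) (hD k)
      (signedArea_sq_lt (hD i) (hD j) (area_lt i j k hij hik hjk))
  have five_ne_two := fun i j k hij hik hjk =>
    translationNumber_halfTurnLift_mul_mul_self_mul_ne (hD i) (hD j) (hD k)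
      (area_lt i j k hij hik hjk)
  have two_lt_words := two_lt_translationNumber_of_word_five
    (fun i => isHalfTurn_halfTurnLift (hD i)) three_ne_one five_ne_two
  have two_lt := lt_mul_rotationNumber_psi (m := 2) hD (mod_cast two_lt_words)
  push_cast at two_lt
  linarith
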